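/- Proposition (Strong Facet-Merging). An mDAG is a pair $\mathfrak{G}=(\mathcal{D},\mathcal{B})$, where $\mathcal{D}$ is a DAG on a finite set $V$ and $\mathcal{B}$ is a simplicial complex over $V$: a set of nonempty subsets of $V$ (faces) that contains all singletons and all nonempty subsets of its members. Facets are the inclusion-maximal faces. Its canonical pDAG $\mathtt{can}(\mathfrak{G})$ is the DAG obtained from $\mathcal{D}$ by adding, for each facet $A$, a parentless latent node whose set of children is $A$; the nodes in $V$ are the visible ones. For $\vec c\in\mathbb{N}^{V}$, $\mathcal{M}(\mathfrak{G},\vec c)$ is the set of all probability distributions $P$ on $X_V=(X_v)_{v\in V}$, where $X_v$ takes $c_v$ values, that can be written $$P(X_V)=\sum_{X_L}\sum_{E}\prod_{a\in V\cup L}\delta_{X_a,\,f_a(X_{\mathtt{pa}(a)},E_a)}\,P_a(E_a),$$ where $L$ is the set of latent nodes and $\mathtt{pa}$ denotes parents in $\mathtt{can}(\mathfrak{G})$, for some choice of finite cardinalities of the latent variables $X_l$ ($l\in L$) and of the error variables $E_a$ ($a\in V\cup L$), of functions $f_a$, and of probability distributions $P_a$ of the error variables. Say that $\mathfrak{G}$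 observationally dominates $\mathfrak{G}'$ ($\mathfrak{G}\succeq\mathfrak{G}'$) if $\mathcal{M}(\mathfrak{G}',\vec c)\subseteq\mathcal{M}(\mathfrak{G},\vec c)$ for all $\vec c\in\mathbb{N}^V$, and that they are observationally equivalent ($\mathfrak{G}\cong\mathfrak{G}'$) if $\mathcal{M}(\mathfrak{G}',\vec c)=\mathcal{M}(\mathfrak{G},\vec c)$ for all $\vec c\in\mathbb{N}^V$. Let $\mathfrak{G}=(\mathcal{D},\mathcal{B})$ be an mDAG, let $C_1,\dots,C_n\in\mathcal{B}$ be facets (not necessarily disjoint from each other), and let $D\in\mathcal{B}$ be a face (for instance a facet) that is disjoint from every $C_i$. Suppose that: 1. $\mathtt{pa}_{\mathcal{D}}(C_i)\cup C_i\subseteq\mathtt{pa}_{\mathcal{D}}(d)$ for all $d\in D$ and $i=1,\dots,n$, where $\mathtt{pa}_{\mathcal{D}}(C_i)=\bigcup_{c\in C_i}\mathtt{pa}_{\mathcal{D}}(c)$; 2. every facet $B'\in\mathcal{B}$ that meets $\bigcup_{i}C_i$ but is not contained in $\bigcup_{i}C_i$ satisfies $D\subseteq B'$. Let $\mathfrak{G}'$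 be the mDAG obtained from $\mathfrak{G}$ by adding the sets $C_i\cup D$, $i=1,\dots,n$, together with all their nonempty subsets, to the simplicial complex. Then $\mathfrak{G}\succeq\mathfrak{G}'$, and moreover $\mathfrak{G}\cong\mathfrak{G}'$. -/

import Mathlib

universe u v w

/-- A directed graph is acyclic if no node reaches itself along one or more directed edges. -/
def DigraphAcyclic {N : Type u} (D : Digraph N) : Prop :=
  ∀ a, ¬ Relation.TransGen D.Adj a a

/-! ### Partitioned DAGs and realizable distributions -/

/-- A partitioned DAG: a DAG whose set of nodes is the disjoint union of a set `V` of visible nodes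
and a set `L` of latent nodes. -/
structure PDAG (V : Type u) (L : Type v) where
  /-- `graph.Adj a b` says that there is a directed edge from `a` to `b`. -/
  graph : Digraph (V ⊕ L)
  acyclic : DigraphAcyclic graph

namespace PDAG

variable {V : Type u} {L : Type v}

/-- The set of parents of a node. -/
def pa (G : PDAG V L) (a : V ⊕ L) : Set (V ⊕ L) := {b | G.graph.Adj b a}

/-- The parameters of a (finite, classical, unrestricted) causal model on `G` whose visible
variables have cardinalities `c`: the cardinalities of the latent variables and of the error
variables, the functions `f a` that determine the variable of a node from the variables of its
parents and from its error variable, and the distributions of the error variables.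
The variable of the node `a` takes values in `Fin (Sum.elim c latCard a)`. -/
structure Params (G : PDAG V L) (c : V → ℕ) where
  latCard : L → ℕ
  errCard : V ⊕ L → ℕ
  f : ∀ a : V ⊕ L, (∀ b : G.pa a, Fin (Sum.elim c latCard b)) → Fin (errCard a) →
    Fin (Sum.elim c latCard a)
  errDist : ∀ a : V ⊕ L, Fin (errCard a) → ℝ
  errDist_mem : ∀ a, errDist a ∈ stdSimplex ℝ (Fin (errCard a))

/-- The joint value of all variables, from the values of the visible and of the latent ones. -/
def jointValue {c : V → ℕ} {cL : L → ℕ} (x : ∀ v, Fin (c v)) (y : ∀ l, Fin (cL l)) :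
    ∀ a : V ⊕ L, Fin (Sum.elim c cL a)
  | Sum.inl v => x v
  | Sum.inr l => y l

open Classical in
/-- The function on the joint values of the visible variables that a choice of parameters yields:
`∑_{X_L} ∑_E ∏_a δ(X_a, f_a(X_{pa(a)}, E_a)) P(E_a)`. -/
noncomputable def Params.visibleDist [Fintype V] [Fintype L] {G : PDAG V L} {c : V → ℕ}
    (θ : G.Params c) (x : ∀ v, Fin (c v)) : ℝ :=
  ∑ y : (∀ l, Fin (θ.latCard l)), ∑ e : (∀ a, Fin (θ.errCard a)), ∏ a : V ⊕ L,
    (if jointValue x y a = θ.f a (fun b => jointValue x y b) (e a) then (1 : ℝ) else 0)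
      * θ.errDist a (e a)

open Classical in
/-- The set `M(G, c)` of the probability distributions on the visible variables, of cardinalities
`c`, that are realizable by `G`, the latent variables having arbitrary finite cardinalities. -/
def realizable [Fintype V] [Fintype L] (G : PDAG V L) (c : V → ℕ) :
    Set ((∀ v, Fin (c v)) → ℝ) :=
  {P | P ∈ stdSimplex ℝ (∀ v, Fin (c v)) ∧ ∃ θ : G.Params c, ∀ x, P x = θ.visibleDist x}

/-- `G` observationally dominates `G'`. -/
def ObsDominates {L' : Type w} [Fintype V] [Fintype L] [Fintype L'] (G : PDAG V L)
    (G' : PDAG V L') : Prop :=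
  ∀ c : V → ℕ, G'.realizable c ⊆ G.realizable c

/-- `G` and `G'` are observationally equivalent. -/
def ObsEquiv {L' : Type w} [Fintype V] [Fintype L] [Fintype L'] (G : PDAG V L)
    (G' : PDAG V L') : Prop :=
  ∀ c : V → ℕ, G'.realizable c = G.realizable c

end PDAG

/-! ### mDAGs -/

/-- An mDAG with set of nodes `V`: a DAG on `V` together with a simplicial complex over `V` (the
faces are the nonempty members; all singletons are faces). -/
structure MDAG (V : Type u) where
  /-- `dir.Adj a b` says that there is a directed edge from `a` to `b`. -/
  dir : Digraph V
  acyclic : DigraphAcyclic dir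
  complex : AbstractSimplicialComplex V

namespace MDAG

variable {V : Type u}

/-- The set of parents of a node in the directed structure. -/
def pa (G : MDAG V) (x : V) : Set V := {y | G.dir.Adj y x}

/-- `A` is a face of the simplicial complex. -/
def IsFace (G : MDAG V) (A : Finset V) : Prop := A ∈ G.complex.faces

/-- `A` is a facet, that is, an inclusion-maximal face. -/
def IsFacet (G : MDAG V) (A : Finset V) : Prop := Maximal G.IsFace A

/-- The type of the facets. -/
abbrev Facet (G : MDAG V) : Type u := {A : Finset V // G.IsFacet A}

noncomputable instance [Fintype V] (G : MDAG V) : Fintype G.Facet := Fintype.ofFinite _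

/-- The graph of the canonical pDAG: the directed structure, with one latent node for each facet
`A` and an edge from it to each element of `A`. -/
def canGraph (G : MDAG V) : Digraph (V ⊕ G.Facet) where
  Adj
    | Sum.inl x, Sum.inl y => G.dir.Adj x y
    | Sum.inr A, Sum.inl y => y ∈ A.1
    | _, Sum.inr _ => False

theorem canGraph_acyclic (G : MDAG V) : DigraphAcyclic G.canGraph := by
  have key : ∀ a b, Relation.TransGen G.canGraph.Adj a b →
      ∃ y, b = Sum.inl y ∧ ∀ x, a = Sum.inl x → Relation.TransGen G.dir.Adj x y := by
    intro a b h
    induction h with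
    | @single b h =>
      rcases b with y | B
      · refine ⟨y, rfl, ?_⟩
        rintro x rfl
        exact Relation.TransGen.single h
      · rcases a with x | A <;> exact h.elim
    | @tail b b' _ h ih =>
      obtain ⟨y, rfl, ih⟩ := ih
      rcases b' with z | B
      · exact ⟨z, rfl, fun x hx => (ih x hx).tail h⟩
      · exact h.elim
  intro a h
  obtain ⟨y, rfl, hy⟩ := key a a h
  exact G.acyclic y (hy y rfl)

/-- The canonical pDAG of an mDAG. -/
def can (G : MDAG V) : PDAG V G.Facet := ⟨G.canGraph, G.canGraph_acyclic⟩

/-- Observational dominance of mDAGs, through their canonical pDAGs. -/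
def ObsDominates [Fintype V] (G G' : MDAG V) : Prop := G.can.ObsDominates G'.can

/-- Observational equivalence of mDAGs, through their canonical pDAGs. -/
def ObsEquiv [Fintype V] (G G' : MDAG V) : Prop := G.can.ObsEquiv G'.can

/-- The mDAG obtained by adding the sets `S i`, and all the faces that they contain, to the
simplicial complex. -/
def addFaces {ι : Type v} (G : MDAG V) (S : ι → Finset V) : MDAG V where
  dir := G.dir
  acyclic := G.acyclic
  complex :=
    { faces := G.complex.faces ∪ {A | A.Nonempty ∧ ∃ i, A ⊆ S i}
      isRelLowerSet_faces := by
        rintro A (hA | ⟨hA, i, hi⟩)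
        · exact ⟨(G.complex.isRelLowerSet_faces hA).1, fun B hBA hB =>
            Or.inl ((G.complex.isRelLowerSet_faces hA).2 hBA hB)⟩
        · exact ⟨hA, fun B hBA hB => Or.inr ⟨hB, i, hBA.trans hi⟩⟩
      singleton_mem := fun v => Or.inl (G.complex.singleton_mem v) }

end MDAG

/-! ### Finite probability -/

/-! One direction is monotonicity: every old facet lies in a facet of the enlarged complex, which
can carry its latent variable. For the other, let C be the union of the C i. Call hidden the latents
of the new facets `C i ∪ D` and of the facets inside C. They influence only C ∪ D, and every other
latent that meets C reaches all of D, by condition 2. By condition 1 the nodes of D also see X_C and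
its parents. So D knows everything that determines the posterior of the hidden latents given X_C.
Let D draw a sample from this posterior, with fresh randomness shared within D, and use it in place
of the true hidden values. By Bayes' rule the visible distribution does not change
(`KernelModel.exists_resample`). Now the latent of `C i ∪ D` acts on C i only, and the fresh
variable acts on the face D, so all scopes fit into facets of the original complex. Stochastic
kernels in place of functions with error variables, and exogenous variables with arbitrary scopes,
make the argument a computation with finite sums. -/

theorem piecewise_apply_congr {ι : Type*} {α : ι → Type*} {s : Set ι} [DecidablePred (· ∈ s)]
    {f f' g g' : ∀ i, α i} {i : ι} (h : i ∈ s → f i = f' i) (h' : i ∉ s → g i = g' i) :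
    s.piecewise f g i = s.piecewise f' g' i := by
  by_cases hi : i ∈ s <;> simp [hi, h, h']

section FiniteProbability

open Classical in
/-- A finite product of probability distributions is a probability distribution. -/
theorem prod_mem_stdSimplex {ι : Type*} [Fintype ι] {α : ι → Type*} [∀ i, Fintype (α i)]
    {p : ∀ i, α i → ℝ} (hp : ∀ i, p i ∈ stdSimplex ℝ (α i)) :
    (fun g : ∀ i, α i => ∏ i, p i (g i)) ∈ stdSimplex ℝ (∀ i, α i) := by
  refine ⟨fun g => Finset.prod_nonneg fun i _ => (hp i).1 _, ?_⟩
  rw [← Fintype.piFinset_univ, ← Finset.prod_univ_sum]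
  exact Finset.prod_eq_one fun i _ => (hp i).2

open Classical in
/-- The marginals of a finite product of probability distributions are its factors. -/
theorem sum_prod_mul_apply {ι : Type*} [Fintype ι] {α : ι → Type*} [∀ i, Fintype (α i)]
    {p : ∀ i, α i → ℝ} (hp : ∀ i, p i ∈ stdSimplex ℝ (α i)) (i : ι) (φ : α i → ℝ) :
    ∑ g : ∀ i, α i, (∏ j, p j (g j)) * φ (g i) = ∑ b, p i b * φ b := by
  -- The test function becomes a product of one-coordinate factors, trivial away from `i`, so that
  -- the sum of products turns into a product of sums.
  have hψ : ∀ g : ∀ i, α i, (∏ j, p j (g j)) * φ (g i) =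
      ∏ j, p j (g j) * (if h : j = i then φ (h ▸ g j) else 1) := by
    intro g
    rw [Finset.prod_mul_distrib, Fintype.prod_eq_single (a := i)
      (f := fun j => if h : j = i then φ (h ▸ g j) else 1) fun j hj => dif_neg hj]
    simp
  rw [Finset.sum_congr rfl fun g _ => hψ g, ← Fintype.piFinset_univ,
    ← Finset.prod_univ_sum (fun _ => Finset.univ)
      fun j b => p j b * (if h : j = i then φ (h ▸ b) else 1),
    Fintype.prod_eq_single i]
  · simp
  · intro j hj
    simp [hj, (hp j).2]

open Classical in
/-- A finite family of probability distributions is the family of distributions of the values of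
functions of a single random variable. -/
theorem exists_functional_representation {α : Type u} {β : Type v} [Finite α] [Fintype β]
    (Q : α → β → ℝ) (hQ : ∀ a, Q a ∈ stdSimplex ℝ β) :
    ∃ (m : ℕ) (q : Fin m → ℝ) (F : α → Fin m → β), q ∈ stdSimplex ℝ (Fin m) ∧
      ∀ a (φ : β → ℝ), ∑ e, q e * φ (F a e) = ∑ b, Q a b * φ b := by
  -- The random variable is a whole function `α → β` with independent values, the one at `a` having
  -- law `Q a`; `F a` evaluates it at `a`.
  have := Fintype.ofFinite α
  let ε := (Fintype.equivFin (α → β)).symm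
  have key := prod_mem_stdSimplex hQ
  refine ⟨_, fun e => ∏ a, Q a (ε e a), fun a e => ε e a, ⟨fun e => key.1 _, ?_⟩, fun a φ => ?_⟩
  · rw [← key.2]
    exact ε.sum_comp fun g => ∏ a, Q a (g a)
  · rw [← sum_prod_mul_apply hQ a φ]
    exact ε.sum_comp fun g => (∏ a, Q a (g a)) * φ (g a)

open Classical in
/-- Resampling some of the coordinates from a product distribution does not change it. -/
theorem sum_prod_mul_eq_resample {ι : Type*} [Fintype ι] {α : ι → Type*} [∀ i, Fintype (α i)]
    {p : ∀ i, α i → ℝ} (hp : ∀ i, p i ∈ stdSimplex ℝ (α i)) (s : Set ι) (Φ : (∀ i, α i) → ℝ) :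
    ∑ l, (∏ i, p i (l i)) * Φ l =
      ∑ l, (∏ i, p i (l i)) * ∑ k, (∏ i, p i (k i)) * Φ (s.piecewise k l) := by
  -- Swapping the coordinates in `s` between two independent copies is an involution that preserves
  -- the product weight.
  let T : (∀ i, α i) × (∀ i, α i) → (∀ i, α i) × (∀ i, α i) := fun lk =>
    (s.piecewise lk.2 lk.1, s.piecewise lk.1 lk.2)
  have hT : Function.Involutive T := by
    rintro ⟨l, k⟩
    ext i <;> by_cases hi : i ∈ s <;> simp [T, hi]
  have hmul : ∀ l k : ∀ i, α i, (∏ i, p i (s.piecewise k l i)) * (∏ i, p i (s.piecewise l k i)) =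
      (∏ i, p i (l i)) * ∏ i, p i (k i) := by
    intro l k
    rw [← Finset.prod_mul_distrib, ← Finset.prod_mul_distrib]
    refine Finset.prod_congr rfl fun i _ => ?_
    by_cases hi : i ∈ s <;> simp [hi, mul_comm]
  calc ∑ l, (∏ i, p i (l i)) * Φ l
      = ∑ lk : (∀ i, α i) × (∀ i, α i),
          ((∏ i, p i (lk.1 i)) * ∏ i, p i (lk.2 i)) * Φ lk.1 := by
        rw [Fintype.sum_prod_type]
        refine Finset.sum_congr rfl fun l _ => ?_
        simp only
        rw [← Finset.sum_mul, ← Finset.mul_sum, (prod_mem_stdSimplex hp).2, mul_one]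
    _ = ∑ lk : (∀ i, α i) × (∀ i, α i),
          ((∏ i, p i (lk.1 i)) * ∏ i, p i (lk.2 i)) * Φ (s.piecewise lk.2 lk.1) := by
        rw [← Equiv.sum_comp hT.toPerm]
        exact Finset.sum_congr rfl fun lk _ => congrArg (· * _) (hmul lk.1 lk.2)
    _ = _ := by
        rw [Fintype.sum_prod_type]
        refine Finset.sum_congr rfl fun l _ => ?_
        rw [Finset.mul_sum]
        exact Finset.sum_congr rfl fun k _ => mul_assoc _ _ _

end FiniteProbability

/-! ### Kernel models -/

namespace MDAG

variable {V : Type u}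

/-- A causal model in which the visible variables are sampled from stochastic kernels: each
exogenous variable `j` influences the nodes of `scope j` only. -/
structure KernelModel (G : MDAG V) (c : V → ℕ) {J : Type v} (scope : J → Set V) where
  card : J → ℕ
  prob : ∀ j, Fin (card j) → ℝ
  prob_mem : ∀ j, prob j ∈ stdSimplex ℝ (Fin (card j))
  ker : ∀ v, (∀ w, Fin (c w)) → (∀ j, Fin (card j)) → Fin (c v) → ℝ
  ker_mem : ∀ v x l, ker v x l ∈ stdSimplex ℝ (Fin (c v))
  ker_congr : ∀ {v x x' l l'}, (∀ w ∈ G.pa v, x w = x' w) → (∀ j, v ∈ scope j → l j = l' j) →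
    ker v x l = ker v x' l'

open Classical in
/-- The distribution of the visible variables in a kernel model. -/
noncomputable def KernelModel.dist [Fintype V] {J : Type v} [Fintype J] {G : MDAG V} {c : V → ℕ}
    {scope : J → Set V} (M : G.KernelModel c scope) (x : ∀ v, Fin (c v)) : ℝ :=
  ∑ l, (∏ j, M.prob j (l j)) * ∏ v, M.ker v x l (x v)

end MDAG

namespace PDAG

variable {V : Type u} {L : Type v} {G : PDAG V L} {c : V → ℕ}

open Classical in
/-- The conditional distribution of the variable of a node, given those of its parents. -/
noncomputable def Params.ker (θ : G.Params c) (a : V ⊕ L)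
    (t : ∀ b : G.pa a, Fin (Sum.elim c θ.latCard b)) (z : Fin (Sum.elim c θ.latCard a)) : ℝ :=
  ∑ e, θ.errDist a e * if z = θ.f a t e then 1 else 0

theorem Params.ker_mem (θ : G.Params c) (a : V ⊕ L)
    (t : ∀ b : G.pa a, Fin (Sum.elim c θ.latCard b)) :
    θ.ker a t ∈ stdSimplex ℝ (Fin (Sum.elim c θ.latCard a)) := by
  classical
  refine ⟨fun z => Finset.sum_nonneg fun e _ => mul_nonneg ((θ.errDist_mem a).1 e) ?_, ?_⟩
  · split_ifs <;> norm_num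
  · unfold ker
    rw [Finset.sum_comm]
    simpa [← Finset.mul_sum] using (θ.errDist_mem a).2

open Classical in
/-- The error variables can be summed out node by node. -/
theorem Params.visibleDist_eq [Fintype V] [Fintype L] (θ : G.Params c) (x : ∀ v, Fin (c v)) :
    θ.visibleDist x = ∑ y : (∀ l, Fin (θ.latCard l)),
      (∏ l, θ.ker (Sum.inr l) (fun b => jointValue x y b) (y l)) *
      ∏ v, θ.ker (Sum.inl v) (fun b => jointValue x y b) (x v) := by
  unfold visibleDist
  refine Finset.sum_congr rfl fun y _ => ?_
  rw [← Fintype.piFinset_univ, ← Finset.prod_univ_sum (fun _ => Finset.univ) fun a b =>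
    (if jointValue x y a = θ.f a (fun b => jointValue x y b) b then (1 : ℝ) else 0) *
      θ.errDist a b, Fintype.prod_sum_type, mul_comm]
  simp only [mul_comm _ (θ.errDist _ _)]
  unfold ker
  congr!

open Classical in
/-- The distributions that factorize into stochastic kernels along the graph are realizable. -/
theorem mem_realizable_of_kernels [Fintype V] [Fintype L] {d : L → ℕ}
    (κV : ∀ v, (∀ b : G.pa (Sum.inl v), Fin (Sum.elim c d b)) → Fin (c v) → ℝ)
    (κL : ∀ l, (∀ b : G.pa (Sum.inr l), Fin (Sum.elim c d b)) → Fin (d l) → ℝ)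
    (hκV : ∀ v t, κV v t ∈ stdSimplex ℝ (Fin (c v)))
    (hκL : ∀ l t, κL l t ∈ stdSimplex ℝ (Fin (d l)))
    {P : (∀ v, Fin (c v)) → ℝ} (hP : P ∈ stdSimplex ℝ (∀ v, Fin (c v)))
    (h : ∀ x, P x = ∑ y : (∀ l, Fin (d l)),
      (∏ l, κL l (fun b => jointValue x y b) (y l)) * ∏ v, κV v (fun b => jointValue x y b) (x v)) :
    P ∈ G.realizable c := by
  let κ : ∀ a : V ⊕ L, (∀ b : G.pa a, Fin (Sum.elim c d b)) → Fin (Sum.elim c d a) → ℝ :=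
    fun a => Sum.rec (motive := fun a => (∀ b : G.pa a, Fin (Sum.elim c d b)) →
      Fin (Sum.elim c d a) → ℝ) κV κL a
  have hκ : ∀ a t, κ a t ∈ stdSimplex ℝ (Fin (Sum.elim c d a)) := by
    rintro (v | l) t
    · exact hκV v t
    · exact hκL l t
  choose m q F hq hF using fun a => exists_functional_representation (κ a) (hκ a)
  have hker : ∀ a t z, Params.ker ⟨d, m, F, q, hq⟩ a t z = κ a t z := by
    intro a t z
    have := hF a t fun b => if z = b then 1 else 0
    simp only [mul_ite, mul_one, mul_zero, Finset.sum_ite_eq, Finset.mem_univ, if_true] at this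
    simp only [Params.ker, mul_ite, mul_one, mul_zero]
    exact this
  refine ⟨hP, ⟨d, m, F, q, hq⟩, fun x => ?_⟩
  rw [h, Params.visibleDist_eq]
  refine Finset.sum_congr rfl fun y _ => ?_
  congr 1
  · exact Finset.prod_congr rfl fun l _ => (hker (Sum.inr l) _ _).symm
  · exact Finset.prod_congr rfl fun v _ => (hker (Sum.inl v) _ _).symm

end PDAG

/-! ### Kernel models and realizable distributions -/

namespace MDAG

variable {V : Type u}

open Classical in
/-- A realizable distribution is the distribution of a kernel model with one exogenous variable for
each facet. -/
theorem exists_kernelModel [Fintype V] {G : MDAG V} {c : V → ℕ} {P : (∀ v, Fin (c v)) → ℝ}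
    (hP : P ∈ G.can.realizable c) :
    ∃ M : G.KernelModel c (fun A : G.Facet => (A.1 : Set V)), ∀ x, P x = M.dist x := by
  obtain ⟨hP, θ, hθ⟩ := hP
  have hempty : ∀ A : G.Facet, IsEmpty (G.can.pa (Sum.inr A)) := by
    rintro A
    refine ⟨?_⟩
    rintro ⟨b | b, hb⟩ <;> exact hb
  have hx : ∀ {v : V} {x x' : ∀ w, Fin (c w)} {y y' : ∀ A, Fin (θ.latCard A)},
      (∀ w ∈ G.pa v, x w = x' w) → (∀ A : G.Facet, v ∈ (A.1 : Set V) → y A = y' A) →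
      (fun b : G.can.pa (Sum.inl v) => PDAG.jointValue x y b.1) =
        fun b : G.can.pa (Sum.inl v) => PDAG.jointValue x' y' b.1 := by
    intro v x x' y y' hx hy
    funext ⟨b, hb⟩
    rcases b with b | b
    · exact hx b hb
    · exact hy b hb
  refine ⟨⟨θ.latCard, fun A => θ.ker (Sum.inr A) fun b => (hempty A).elim b, fun A => θ.ker_mem (Sum.inr A) _,
    fun v x y => θ.ker (Sum.inl v) fun b => PDAG.jointValue x y b, fun v x y => θ.ker_mem (Sum.inl v) _,
    fun h₁ h₂ => congrArg (θ.ker (Sum.inl _)) (hx h₁ h₂)⟩, fun x => ?_⟩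
  rw [hθ, PDAG.Params.visibleDist_eq, KernelModel.dist]
  refine Finset.sum_congr rfl fun y _ => ?_
  congr 1
  refine Finset.prod_congr rfl fun A _ => ?_
  rw [Subsingleton.elim (fun b : G.can.pa (Sum.inr A) => PDAG.jointValue x y b)
    fun b => (hempty A).elim b]

open Classical in
/-- The distribution of a kernel model in which the scope of each exogenous variable is contained
in a facet is realizable. -/
theorem realizable_of_kernelModel [Fintype V] {G : MDAG V} {c : V → ℕ} {J : Type v} [Fintype J]
    {scope : J → Set V} (M : G.KernelModel c scope) {P : (∀ v, Fin (c v)) → ℝ}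
    (hP : P ∈ stdSimplex ℝ (∀ v, Fin (c v))) (hM : ∀ x, P x = M.dist x)
    (ρ : J → G.Facet) (hρ : ∀ j, scope j ⊆ (ρ j).1) : P ∈ G.can.realizable c := by
  -- The latent of a facet carries the tuple of all the exogenous variables assigned to it.
  let S : G.Facet → Type v := fun A => ∀ j : {j // ρ j = A}, Fin (M.card j)
  obtain ⟨d, ⟨ε⟩⟩ : ∃ d : G.Facet → ℕ, Nonempty (∀ A, S A ≃ Fin (d A)) :=
    ⟨_, ⟨fun A => Fintype.equivFin (S A)⟩⟩
  let ψ : (∀ j, Fin (M.card j)) ≃ ∀ A, Fin (d A) :=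
    { toFun := fun l A => ε A fun j => l j
      invFun := fun y j => (ε (ρ j)).symm (y (ρ j)) ⟨j, rfl⟩
      left_inv := fun l => by simp
      right_inv := fun y => by
        funext A
        rw [← Equiv.eq_symm_apply]
        funext ⟨j, hj⟩
        subst hj
        rfl }
  have hx₀ : Nonempty (∀ v, Fin (c v)) := by
    by_contra h
    rw [not_nonempty_iff] at h
    simpa using hP.2
  have hl₀ : Nonempty (∀ j, Fin (M.card j)) := by
    by_contra h
    rw [not_nonempty_iff] at h
    simpa using (prod_mem_stdSimplex M.prob_mem).2
  obtain ⟨x₀⟩ := hx₀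
  obtain ⟨l₀⟩ := hl₀
  let r : ∀ A, Fin (d A) → ℝ := fun A y =>
    ∏ j : {j // ρ j = A}, M.prob j ((ε A).symm y j)
  have hr : ∀ A, r A ∈ stdSimplex ℝ (Fin (d A)) := by
    intro A
    have key := prod_mem_stdSimplex fun j : {j // ρ j = A} => M.prob_mem j
    refine ⟨fun y => key.1 _, ?_⟩
    rw [← key.2]
    convert (ε A).symm.sum_comp fun k : S A => ∏ j : {j // ρ j = A}, M.prob j (k j)
  -- The values `x₀` and `l₀` stand in for the nodes that are not parents of `v`; by `ker_congr`
  -- they do not matter.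
  refine PDAG.mem_realizable_of_kernels (G := G.can)
    (fun v t => M.ker v (fun w => if h : Sum.inl w ∈ G.can.pa (Sum.inl v) then t ⟨Sum.inl w, h⟩ else x₀ w)
      (ψ.symm fun A => if h : Sum.inr A ∈ G.can.pa (Sum.inl v) then t ⟨Sum.inr A, h⟩ else ψ l₀ A))
    (fun A _ => r A) (fun v t => M.ker_mem _ _ _) (fun A _ => hr A) hP fun x => ?_
  rw [hM, KernelModel.dist]
  rw [← Equiv.sum_comp ψ.symm]
  refine Finset.sum_congr (by congr!) fun y _ => ?_
  congr 1
  · rw [← Fintype.prod_fiberwise ρ]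
    refine Finset.prod_congr rfl fun A _ => Finset.prod_congr rfl fun j _ => ?_
    obtain ⟨j, rfl⟩ := j
    rfl
  · refine Finset.prod_congr rfl fun v _ => ?_
    refine congrFun (M.ker_congr (fun w hw => ?_) fun j hj => ?_) _
    · have hw' : Sum.inl w ∈ G.can.pa (Sum.inl v) := hw
      exact (dif_pos (t := fun _ => x w) (e := fun _ => x₀ w) hw').symm
    · have hv : Sum.inr (ρ j) ∈ G.can.pa (Sum.inl v) := hρ j hj
      simp [ψ, hv, PDAG.jointValue]

end MDAG

/-! ### Adding faces -/

namespace MDAG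

variable {V : Type u}

theorem addFaces_isFace_iff {ι : Type v} {G : MDAG V} {S : ι → Finset V} {A : Finset V} :
    (G.addFaces S).IsFace A ↔ G.IsFace A ∨ A.Nonempty ∧ ∃ i, A ⊆ S i := Iff.rfl

theorem IsFace.exists_isFacet [Finite V] {G : MDAG V} {A : Finset V} (hA : G.IsFace A) :
    ∃ B, A ⊆ B ∧ G.IsFacet B :=
  Set.Finite.exists_le_maximal (Set.toFinite {A | G.IsFace A}) hA

/-- A facet of the enlarged complex is one of the added sets or a facet of the old one. -/
theorem isFacet_of_addFaces {ι : Type v} {G : MDAG V} {S : ι → Finset V} {A : Finset V}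
    (hA : (G.addFaces S).IsFacet A) (hS : ∀ i, A ≠ S i) : G.IsFacet A := by
  refine ⟨?_, fun B hB hAB => hA.2 (Or.inl hB) hAB⟩
  rcases addFaces_isFace_iff.1 hA.1 with h | ⟨h, i, hi⟩
  · exact h
  · exact (hS i (hi.antisymm (hA.2 (Or.inr ⟨h.mono hi, i, subset_rfl⟩) hi))).elim

/-- Adding faces enlarges the set of realizable distributions. -/
theorem addFaces_obsDominates [Fintype V] {ι : Type v} (G : MDAG V) (S : ι → Finset V) :
    (G.addFaces S).ObsDominates G := by
  intro c P hP
  obtain ⟨M, hM⟩ := exists_kernelModel hP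
  choose ρ hρ hρ' using fun A : G.Facet =>
    IsFace.exists_isFacet (G := G.addFaces S) (A := A.1) (Or.inl A.2.1)
  let M' : (G.addFaces S).KernelModel c (fun A : G.Facet => (A.1 : Set V)) :=
    ⟨M.card, M.prob, M.prob_mem, M.ker, M.ker_mem, M.ker_congr⟩
  exact realizable_of_kernelModel M' hP.1 hM (fun A => ⟨ρ A, hρ' A⟩) fun A => hρ A

/-! ### Replacing exogenous variables by samples from their posterior -/

namespace KernelModel

open Classical in
/-- A kernel model whose exogenous variables are indexed by `Option J`, from a distinguished
variable and a family of variables indexed by `J`. -/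
theorem exists_option [Fintype V] {G : MDAG V} {c : V → ℕ} {J : Type v} [Fintype J]
    {scope₀ : Set V} {scope : J → Set V} {m : ℕ} {q : Fin m → ℝ} (hq : q ∈ stdSimplex ℝ (Fin m))
    {card : J → ℕ} {prob : ∀ j, Fin (card j) → ℝ} (hprob : ∀ j, prob j ∈ stdSimplex ℝ (Fin (card j)))
    (ker : ∀ v, (∀ w, Fin (c w)) → Fin m → (∀ j, Fin (card j)) → Fin (c v) → ℝ)
    (hker : ∀ v x z l, ker v x z l ∈ stdSimplex ℝ (Fin (c v)))
    (ker_congr : ∀ {v x x' z z' l l'}, (∀ w ∈ G.pa v, x w = x' w) → (v ∈ scope₀ → z = z') →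
      (∀ j, v ∈ scope j → l j = l' j) → ker v x z l = ker v x' z' l') :
    ∃ M : G.KernelModel c (fun o : Option J => o.elim scope₀ scope), ∀ x,
      M.dist x = ∑ z, ∑ l, (q z * ∏ j, prob j (l j)) * ∏ v, ker v x z l (x v) := by
  let r : ∀ o : Option J, Fin (o.elim m card) → ℝ := fun o =>
    Option.rec (motive := fun o => Fin (o.elim m card) → ℝ) q prob o
  have hr : ∀ o, r o ∈ stdSimplex ℝ (Fin (o.elim m card)) := by
    rintro (_ | j)
    · exact hq
    · exact hprob j
  refine ⟨⟨fun o => o.elim m card, r, hr, fun v x l => ker v x (l none) fun j => l (some j),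
    fun v x l => hker _ _ _ _, fun hx hl => ker_congr hx (hl none) fun j => hl (some j)⟩,
    fun x => ?_⟩
  have hsum : ∀ φ : (∀ o : Option J, Fin (o.elim m card)) → ℝ,
      ∑ l, φ l = ∑ z, ∑ l, φ (Equiv.piOptionEquivProd.symm (z, l)) := by
    intro φ
    rw [← Equiv.sum_comp Equiv.piOptionEquivProd.symm, Fintype.sum_prod_type]
  refine Eq.trans (Finset.sum_congr (by congr!) fun _ _ => rfl) ((hsum _).trans ?_)
  refine Finset.sum_congr rfl fun z _ => Finset.sum_congr rfl fun l _ => ?_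
  rw [Fintype.prod_option]
  rfl

open Classical in
/-- **Resampling.** Let the nodes of `C` be followed by those of `D`, let every exogenous variable
that influences `C` and is not in `s` influence all of `D`, and let the variables of `s`
influence only `C ∪ D`. Then the nodes outside `C` need not see the variables of `s`, provided that
those in `D` share a new exogenous variable. -/
theorem exists_resample [Fintype V] {G : MDAG V} {c : V → ℕ} {J : Type v} [Fintype J]
    {scope : J → Set V} (M : G.KernelModel c scope) (C D : Set V) (s : Set J)
    (hCD : Disjoint C D) (hpa : ∀ d ∈ D, ∀ v ∈ C, v ∈ G.pa d ∧ G.pa v ⊆ G.pa d)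
    (hs : ∀ j ∈ s, scope j ⊆ C ∪ D)
    (hsc : ∀ j ∉ s, (scope j ∩ C).Nonempty → D ⊆ scope j)
    (hx₀ : Nonempty (∀ v, Fin (c v))) :
    ∃ M' : G.KernelModel c (fun o : Option J =>
        o.elim D fun j => {v ∈ scope j | j ∈ s → v ∉ D}), ∀ x, M'.dist x = M.dist x := by
  have hl₀ : Nonempty (∀ j, Fin (M.card j)) := by
    by_contra h
    rw [not_nonempty_iff] at h
    simpa using (prod_mem_stdSimplex M.prob_mem).2
  obtain ⟨x₀⟩ := hx₀
  obtain ⟨l₀⟩ := hl₀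
  -- `W` and `R` index the exogenous variables outside `s` and the visible variables on which the
  -- posterior depends; `h` is the likelihood of the values on `C`, and `g` is its average over the
  -- variables of `s`.
  let W : Set J := {j | j ∉ s ∧ (scope j ∩ C).Nonempty}
  let R : Set V := {w | w ∈ C ∨ ∃ v ∈ C, w ∈ G.pa v}
  let h : (∀ v, Fin (c v)) → (∀ j, Fin (M.card j)) → ℝ := fun x l => ∏ v with v ∈ C, M.ker v x l (x v)
  let p : (∀ j, Fin (M.card j)) → ℝ := fun l => ∏ j, M.prob j (l j)
  have hp : p ∈ stdSimplex ℝ (∀ j, Fin (M.card j)) := prod_mem_stdSimplex M.prob_mem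
  have hh : ∀ x l, 0 ≤ h x l := fun x l => Finset.prod_nonneg fun v _ => (M.ker_mem v x l).1 _
  let g : (∀ v, Fin (c v)) → (∀ j, Fin (M.card j)) → ℝ := fun x l => ∑ k, p k * h x (s.piecewise k l)
  have hph : ∀ x l k, 0 ≤ p k * h x (s.piecewise k l) := fun x l k => mul_nonneg (hp.1 k) (hh _ _)
  -- The posterior, with the prior as fallback when the likelihood vanishes, so that `Q` is a
  -- distribution in every case.
  let Q : (∀ v, Fin (c v)) × (∀ j, Fin (M.card j)) → (∀ j, Fin (M.card j)) → ℝ := fun a k =>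
    if g a.1 a.2 = 0 then p k else p k * h a.1 (s.piecewise k a.2) / g a.1 a.2
  have hQ : ∀ a, Q a ∈ stdSimplex ℝ (∀ j, Fin (M.card j)) := by
    intro a
    by_cases ha : g a.1 a.2 = 0
    · simpa only [Q, ha, if_true] using hp
    · simp only [Q, ha, if_false]
      refine ⟨fun k => div_nonneg (hph _ _ _) (Finset.sum_nonneg fun k _ => hph _ _ _), ?_⟩
      rw [← Finset.sum_div]
      exact div_self ha
  have hgQ : ∀ x l k, g x l * Q (x, l) k = p k * h x (s.piecewise k l) := by
    intro x l k
    by_cases ha : g x l = 0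
    · rw [ha, zero_mul]
      exact ((Finset.sum_eq_zero_iff_of_nonneg fun k _ => hph x l k).1 ha k
        (Finset.mem_univ _)).symm
    · simp only [Q, ha, if_false]
      field_simp
  -- Everything that `D` cannot see is overwritten by defaults, which leaves the posterior
  -- unchanged.
  let α : (∀ v, Fin (c v)) → (∀ j, Fin (M.card j)) → (∀ v, Fin (c v)) × (∀ j, Fin (M.card j)) :=
    fun x l => (R.piecewise x x₀, W.piecewise l l₀)
  have hhα : ∀ x l k, h (α x l).1 (s.piecewise k (α x l).2) = h x (s.piecewise k l) := by
    intro x l k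
    refine Finset.prod_congr rfl fun v hv => ?_
    have hv : v ∈ C := (Finset.mem_filter.1 hv).2
    have hxR : ∀ w ∈ R, (α x l).1 w = x w := fun w hw => Set.piecewise_eq_of_mem _ _ _ hw
    have hxv : (α x l).1 v = x v := hxR v (Or.inl hv)
    rw [hxv]
    refine congrFun (M.ker_congr (fun w hw => ?_) fun j hj => ?_) _
    · exact hxR w (Or.inr ⟨v, hv, hw⟩)
    · by_cases hjs : j ∈ s
      · simp [hjs]
      · have : j ∈ W := ⟨hjs, v, hj, hv⟩
        simp [hjs, α, this]
  have hgα : ∀ x l, g (α x l).1 (α x l).2 = g x l := fun x l =>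
    Finset.sum_congr rfl fun k _ => by rw [hhα]
  have hQα : ∀ x l, Q (α x l) = Q (x, l) := by
    intro x l
    funext k
    simp only [Q, hgα, hhα]
  obtain ⟨m, q, F, hq, hF⟩ := exists_functional_representation Q hQ
  obtain ⟨M', hM'⟩ := exists_option (G := G) (scope₀ := D)
    (scope := fun j => {v ∈ scope j | j ∈ s → v ∉ D}) hq M.prob_mem
    (fun v x z l => M.ker v x (if v ∈ C then l else s.piecewise (F (α x l) z) l))
    (fun v x z l => M.ker_mem _ _ _) (by
      intro v x x' z z' l l' hx hz hl
      refine M.ker_congr hx fun j hj => ?_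
      by_cases hvC : v ∈ C
      · simpa only [hvC, if_true] using hl j ⟨hj, fun _ => hCD.notMem_of_mem_left hvC⟩
      simp only [hvC, if_false]
      refine piecewise_apply_congr (fun hjs => ?_) fun hjs => hl j ⟨hj, fun h => (hjs h).elim⟩
      -- Outside `C`, only nodes of `D` read a coordinate in `s`, and these see all of `R` and `W`
      -- as well as the fresh `z`.
      have hvD : v ∈ D := (hs j hjs hj).resolve_left hvC
      have hα : α x l = α x' l' := by
        refine Prod.ext (funext fun w => ?_) (funext fun i => ?_)
        · refine piecewise_apply_congr (s := R) (fun hw => hx w ?_) fun _ => rfl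
          rcases hw with hw | ⟨u, hu, hw⟩
          · exact (hpa v hvD w hw).1
          · exact (hpa v hvD u hu).2 hw
        · exact piecewise_apply_congr (s := W)
            (fun hi => hl i ⟨hsc i hi.1 hi.2 hvD, fun h => (hi.1 h).elim⟩) fun _ => rfl
      rw [hα, hz hvD])
  let e : (∀ v, Fin (c v)) → (∀ j, Fin (M.card j)) → ℝ := fun x l => ∏ v with v ∉ C, M.ker v x l (x v)
  refine ⟨M', fun x => ?_⟩
  have hres := sum_prod_mul_eq_resample M.prob_mem s
  have hpp : ∀ k l l' : ∀ j, Fin (M.card j),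
      s.piecewise k (s.piecewise l' l) = s.piecewise k l := by
    intro k l l'
    funext j
    by_cases hj : j ∈ s <;> simp [hj]
  have hQp : ∀ l k, Q (x, s.piecewise k l) = Q (x, l) := by
    intro l k
    funext k'
    simp only [Q, g, hpp]
  calc M'.dist x
      = ∑ z, ∑ l, (q z * p l) * (h x l * e x (s.piecewise (F (α x l) z) l)) := by
        rw [hM']
        refine Finset.sum_congr rfl fun z _ => Finset.sum_congr rfl fun l _ =>
          congrArg (q z * p l * ·) ?_
        rw [← Finset.prod_filter_mul_prod_filter_not _ (· ∈ C)]
        refine congrArg₂ (· * ·) (Finset.prod_congr rfl fun v hv => ?_)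
          (Finset.prod_congr rfl fun v hv => ?_)
        · rw [if_pos (Finset.mem_filter.1 hv).2]
        · rw [if_neg (Finset.mem_filter.1 hv).2]
    _ = ∑ l, p l * (h x l * ∑ k, Q (x, l) k * e x (s.piecewise k l)) := by
        rw [Finset.sum_comm]
        refine Finset.sum_congr rfl fun l _ => ?_
        rw [← hQα, ← hF, Finset.mul_sum, Finset.mul_sum]
        exact Finset.sum_congr rfl fun z _ => by ring
    -- The coordinates in `s` are split off as an independent copy `k`; the posterior ignores their
    -- old values.
    _ = ∑ l, p l * ∑ k, p k * (h x (s.piecewise k l) *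
          ∑ k', Q (x, l) k' * e x (s.piecewise k' l)) := by
        rw [hres]
        simp only [hpp, hQp, p]
    -- Bayes' rule: summing the likelihood over `k` gives `g`, and `g` times the posterior is prior
    -- times likelihood.
    _ = ∑ l, p l * ∑ k, p k * (h x (s.piecewise k l) * e x (s.piecewise k l)) := by
        refine Finset.sum_congr rfl fun l _ => congrArg (p l * ·) ?_
        simp only [← mul_assoc]
        rw [← Finset.sum_mul, Finset.mul_sum]
        exact Finset.sum_congr rfl fun k _ => by rw [← hgQ, mul_assoc]
    _ = ∑ l, p l * (h x l * e x l) := (hres fun l => h x l * e x l).symm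
    _ = M.dist x := by
        refine Finset.sum_congr rfl fun l _ => congrArg (p l * ·) ?_
        exact Finset.prod_filter_mul_prod_filter_not _ _ _

end KernelModel

end MDAG

/-- Strong facet-merging: adding the merged facets `C i ∪ D` to the simplicial complex of `G` yields
an observationally dominated, hence observationally equivalent, mDAG. -/
theorem mainTheorem2 {V : Type*} [Fintype V] [DecidableEq V] (G : MDAG V) {n : ℕ}
    (C : Fin n → Finset V) (D : Finset V)
    (hC : ∀ i, G.IsFacet (C i)) (hD : G.IsFace D)
    (hdisj : ∀ i, Disjoint (C i) D)
    (hpa : ∀ i, ∀ d ∈ D, (⋃ c ∈ C i, G.pa c) ∪ (C i : Set V) ⊆ G.pa d)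
    (hfacet : ∀ B : Finset V, G.IsFacet B → ¬ ((B : Set V) ⊆ ⋃ i, (C i : Set V)) →
      ((B : Set V) ∩ ⋃ i, (C i : Set V)).Nonempty → D ⊆ B) :
    G.ObsDominates (G.addFaces fun i => C i ∪ D) ∧
      G.ObsEquiv (G.addFaces fun i => C i ∪ D) := by
  have key : G.ObsDominates (G.addFaces fun i => C i ∪ D) := by
    intro c P hP
    obtain ⟨M, hM⟩ := MDAG.exists_kernelModel hP
    have hx₀ : Nonempty (∀ v, Fin (c v)) := by
      by_contra h
      rw [not_nonempty_iff] at h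
      simpa using hP.1.2
    have hold : ∀ A : (G.addFaces fun i => C i ∪ D).Facet, (∀ i, A.1 ≠ C i ∪ D) → G.IsFacet A.1 :=
      fun A => MDAG.isFacet_of_addFaces A.2
    -- Facets inside the union of the `C i` are resampled too, since `D` does not see their latents.
    obtain ⟨M', hM'⟩ := M.exists_resample (⋃ i, (C i : Set V)) (D : Set V)
      {A | (∃ i, A.1 = C i ∪ D) ∨ (A.1 : Set V) ⊆ ⋃ i, (C i : Set V)}
      (by
        rw [Set.disjoint_iUnion_left]
        exact fun i => Finset.disjoint_coe.2 (hdisj i))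
      (by
        intro d hd v hv
        obtain ⟨i, hi⟩ := Set.mem_iUnion.1 hv
        exact ⟨hpa i d hd (Or.inr hi), fun w hw => hpa i d hd (Or.inl (Set.mem_biUnion hi hw))⟩)
      (by
        rintro A (⟨i, hi⟩ | hA)
        · rw [hi, Finset.coe_union]
          exact Set.union_subset_union_left _ (Set.subset_iUnion (fun i => (C i : Set V)) i)
        · exact hA.trans Set.subset_union_left)
      (by
        intro A hA hAC
        obtain ⟨hA₁, hA₂⟩ := not_or.1 hA
        exact Finset.coe_subset.2 (hfacet _ (hold A (not_exists.1 hA₁)) hA₂ hAC))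
      hx₀
    have hρ : ∀ o : Option (G.addFaces fun i => C i ∪ D).Facet, ∃ B : G.Facet,
        (o.elim (D : Set V) fun A => {v ∈ (A.1 : Set V) | A ∈ {A : (G.addFaces fun i => C i ∪ D).Facet |
          (∃ i, A.1 = C i ∪ D) ∨ (A.1 : Set V) ⊆ ⋃ i, (C i : Set V)} → v ∉ (D : Set V)}) ⊆
          (B.1 : Set V) := by
      rintro (_ | A)
      · obtain ⟨B, hDB, hB⟩ := hD.exists_isFacet
        exact ⟨⟨B, hB⟩, hDB⟩
      · by_cases hA : ∃ i, A.1 = C i ∪ D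
        · obtain ⟨i, hi⟩ := hA
          refine ⟨⟨C i, hC i⟩, fun v hv => ?_⟩
          have hv₁ : v ∈ C i ∪ D := hi ▸ hv.1
          exact (Finset.mem_union.1 hv₁).resolve_right (hv.2 (Or.inl ⟨i, hi⟩))
        · exact ⟨⟨A.1, hold A (not_exists.1 hA)⟩, fun v hv => hv.1⟩
    choose ρ hρ using hρ
    -- A kernel model involves only the directed structure, which both mDAGs share.
    let M'' : G.KernelModel c _ :=
      ⟨M'.card, M'.prob, M'.prob_mem, M'.ker, M'.ker_mem, M'.ker_congr⟩
    exact MDAG.realizable_of_kernelModel M'' hP.1 (fun x => (hM x).trans (hM' x).symm) ρ hρ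
  exact ⟨key, fun c => (key c).antisymm (MDAG.addFaces_obsDominates G _ c)⟩
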